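/- Let $R$ be a Noetherian local domain of prime characteristic $p$. Let $R^+$ be the integral closure of $R$ in an algebraic closure of its field of fractions, and let $R_\infty := \{x \in R^+ : x^{p^n} \in R \text{ for some } n \ge 0\}$ be the perfect closure of $R$. For a module $M$ over a commutative ring $A$, let $\mathrm{fd}_A(M)$ and $\mathrm{pd}_A(M)$ denote its flat and projective dimension. Then: (i) if $A$ is either $R_\infty$ or $R^+$, then $\sup\{\mathrm{fd}_A(A/\mathfrak{a}) : \mathfrak{a} \text{ is a radical ideal of } A\} \le \dim R$; (ii) $\sup\{\mathrm{pd}_{R_\infty}(R_\infty/\mathfrak{a}) : \mathfrak{a} \text{ is a radical ideal of } R_\infty\} \le \dim R + 1$. -/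

import Mathlib

open CategoryTheory

universe u v w

/-- The absolute integral closure `R⁺` of a domain `R`: the integral closure of `R` in `L`, where
`L` is an algebraic closure of the field of fractions of `R` (the theorem assumes that `L` is
one). -/
abbrev absoluteIntegralClosure (R : Type u) (L : Type w) [CommRing R] [Field L] [Algebra R L] :
    Subalgebra R L :=
  integralClosure R L

/-- The perfect closure `R_∞` of a domain `R` of prime characteristic `p`: the ring of all
`x ∈ R⁺` such that `x ^ (p ^ n) ∈ R` for some `n ≥ 0`, where `R⁺` is taken inside an algebraic
closure `L` of the field of fractions of `R`. -/
def perfectClosureOfDomain (R : Type u) (L : Type w) [CommRing R] [Field L] [Algebra R L]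
    (p : ℕ) [Fact p.Prime] [CharP R p] : Subalgebra R L where
  carrier := {x | x ∈ absoluteIntegralClosure R L ∧
    ∃ n : ℕ, x ^ (p ^ n) ∈ Set.range (algebraMap R L)}
  algebraMap_mem' r := ⟨Subalgebra.algebraMap_mem _ r, 0, r, by simp⟩
  mul_mem' := by
    rintro x y ⟨hx, m, a, ha⟩ ⟨hy, n, b, hb⟩
    refine ⟨Subalgebra.mul_mem _ hx hy, m + n, a ^ (p ^ n) * b ^ (p ^ m), ?_⟩
    rw [map_mul, map_pow, map_pow, ha, hb, mul_pow, pow_add, pow_mul, mul_comm (p ^ m) (p ^ n),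
      pow_mul y]
  add_mem' := by
    rintro x y ⟨hx, m, a, ha⟩ ⟨hy, n, b, hb⟩
    have hp : (p : L) = 0 := by
      rw [← map_natCast (algebraMap R L) p, CharP.cast_eq_zero, map_zero]
    have : CharP L p := (CharP.charP_iff_prime_eq_zero Fact.out).2 hp
    refine ⟨Subalgebra.add_mem _ hx hy, m + n, a ^ (p ^ n) + b ^ (p ^ m), ?_⟩
    rw [map_add, map_pow, map_pow, ha, hb, add_pow_char_pow, pow_add, pow_mul,
      mul_comm (p ^ m) (p ^ n), pow_mul y]

/-- `M` has flat dimension `< n`: `Tor_i^A(M, N) = 0` for all `i ≥ n` and all `A`-modules `N`. -/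
def HasFlatDimensionLT {A : Type u} [CommRing A] (M : ModuleCat.{u} A) (n : ℕ) : Prop :=
  ∀ i : ℕ, n ≤ i → ∀ N : ModuleCat.{u} A,
    Limits.IsZero (((Tor (ModuleCat.{u} A) i).obj M).obj N)

/-- The flat dimension `fd_A(M)`, with the same conventions as `projectiveDimension`: it is `⊥`
for the zero module, and `⊤` if the flat dimension is not finite. -/
noncomputable def flatDimension {A : Type u} [CommRing A] (M : ModuleCat.{u} A) : WithBot ℕ∞ :=
  sInf {n : WithBot ℕ∞ | ∀ i : ℕ, n < i → HasFlatDimensionLT M i}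

/-- The residue ring `A ⧸ a` of an ideal `a`, as an `A`-module. -/
abbrev residueModule {A : Type u} [CommRing A] (a : Ideal A) : ModuleCat.{u} A :=
  ModuleCat.of A (A ⧸ a)

/-! ### Tor, flat dimension and directed unions of ideals -/

section Tor

open MonoidalCategory

variable {A : Type u} [CommRing A]

/-! Both closures are perfect domains `A`, integral over `R`. In such an `A`, the ideal `√(w)` is
the increasing union of the ideals generated by the roots `w^(1/p^n)`. For `w ≠ 0` these are free,
so `√(w)` is flat, and a telescope gives it projective dimension at most one. Bijectivity of
Frobenius also makes radicals commute with sums. As `√(w) ∩ √(y) = √(wy)`, attaching a generator `y`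
to the ideal gives an exact sequence whose outer terms have the same shape, with `w` replaced by
`wy` in the kernel. Each generator therefore costs one dimension: `A/√(x₁, …, x_k)` has flat
dimension at most `k` and projective dimension at most `k + 1`
(`residueModule_radical_ofList_of_shortExact`).

It remains to bound the number of generators up to radical by `d = dim R`. Prime avoidance does this
in semilocal Noetherian domains of dimension at most `d`. Every element of `R_∞` has a power in `R`,
so a proper radical ideal of `R_∞` is the radical of `d` elements of `R`. Over `R⁺` a proper radical
ideal is only a directed union of radicals of `d` elements, found in finite subextensions; flat
dimension passes to such unions. -/

theorem isZero_tor_iff_exactAt (M : ModuleCat.{u} A) {N : ModuleCat.{u} A}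
    (P : ProjectiveResolution N) (i : ℕ) :
    Limits.IsZero (((Tor (ModuleCat.{u} A) i).obj M).obj N) ↔
      ((((tensoringLeft (ModuleCat.{u} A)).obj M).mapHomologicalComplex
        (ComplexShape.down ℕ)).obj P.complex).ExactAt i := by
  rw [HomologicalComplex.exactAt_iff_isZero_homology]
  exact (P.isoLeftDerivedObj ((tensoringLeft (ModuleCat.{u} A)).obj M) i).isZero_iff

theorem isZero_tor_succ_iff_exact (M : ModuleCat.{u} A) {N : ModuleCat.{u} A}
    (P : ProjectiveResolution N) (i : ℕ) :
    Limits.IsZero (((Tor (ModuleCat.{u} A) (i + 1)).obj M).obj N) ↔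
      Function.Exact ((P.complex.d (i + 2) (i + 1)).hom.lTensor M)
        ((P.complex.d (i + 1) i).hom.lTensor M) := by
  rw [isZero_tor_iff_exactAt M P, HomologicalComplex.exactAt_iff' _ (i + 2) (i + 1) i (by simp)
    (by simp), ShortComplex.ShortExact.moduleCat_exact_iff_function_exact]
  rfl

theorem hasFlatDimensionLT_one_of_flat (M : ModuleCat.{u} A) [Module.Flat A M] :
    HasFlatDimensionLT M 1 := by
  intro i hi N
  obtain ⟨i, rfl⟩ := Nat.exists_eq_succ_of_ne_zero (by omega : i ≠ 0)
  let P := projectiveResolution N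
  rw [Nat.succ_eq_add_one, isZero_tor_succ_iff_exact M P]
  refine Module.Flat.lTensor_exact M ?_
  rw [← ShortComplex.ShortExact.moduleCat_exact_iff_function_exact
    (ShortComplex.mk (P.complex.d (i + 2) (i + 1)) (P.complex.d (i + 1) i) (by simp))]
  have := P.complex_exactAt_succ i
  rwa [HomologicalComplex.exactAt_iff' _ (i + 2) (i + 1) i (by simp) (by simp)] at this

theorem HasFlatDimensionLT.mono {M : ModuleCat.{u} A} {m n : ℕ} (h : HasFlatDimensionLT M m)
    (hmn : m ≤ n) : HasFlatDimensionLT M n :=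
  fun i hi N ↦ h i (hmn.trans hi) N

theorem HasFlatDimensionLT.of_iso {M M' : ModuleCat.{u} A} {n : ℕ} (h : HasFlatDimensionLT M n)
    (e : M ≅ M') : HasFlatDimensionLT M' n :=
  fun i hi N ↦ (h i hi N).of_iso ((((Tor (ModuleCat.{u} A) i).mapIso e).app N).symm)

theorem flatDimension_le_of_hasFlatDimensionLT {M : ModuleCat.{u} A} {n : ℕ}
    (h : HasFlatDimensionLT M (n + 1)) : flatDimension M ≤ n :=
  sInf_le fun i hi ↦ h.mono (by exact_mod_cast hi)

theorem hasFlatDimensionLT_of_isZero {M : ModuleCat.{u} A} (hM : Limits.IsZero M) :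
    HasFlatDimensionLT M 0 := by
  intro i _ N
  rw [isZero_tor_iff_exactAt M (projectiveResolution N) i]
  refine ShortComplex.exact_of_isZero_X₂ _ ?_
  have := ModuleCat.isZero_iff_subsingleton.1 hM
  exact ModuleCat.isZero_iff_subsingleton.2
    (inferInstanceAs (Subsingleton (TensorProduct A M ((projectiveResolution N).complex.X i))))

theorem flatDimension_eq_bot_of_isZero {M : ModuleCat.{u} A} (hM : Limits.IsZero M) :
    flatDimension M = ⊥ :=
  le_bot_iff.1 <| sInf_le fun _ _ ↦ (hasFlatDimensionLT_of_isZero hM).mono (Nat.zero_le _)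

/-- Tensoring a short exact sequence with a projective resolution yields a short exact sequence of
complexes. -/
theorem shortExact_tensor_projectiveResolution {S : ShortComplex (ModuleCat.{u} A)}
    (hS : S.ShortExact) {N : ModuleCat.{u} A} (P : ProjectiveResolution N) :
    (ShortComplex.mk
      ((NatTrans.mapHomologicalComplex ((tensoringLeft (ModuleCat.{u} A)).map S.f)
        (ComplexShape.down ℕ)).app P.complex)
      ((NatTrans.mapHomologicalComplex ((tensoringLeft (ModuleCat.{u} A)).map S.g)
        (ComplexShape.down ℕ)).app P.complex) (by
          rw [← NatTrans.comp_app, ← NatTrans.mapHomologicalComplex_comp, ← Functor.map_comp, S.zero]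
          ext; simp; rfl)).ShortExact := by
  refine HomologicalComplex.shortExact_of_degreewise_shortExact _ fun i ↦ ?_
  have : Module.Projective A (P.complex.X i) :=
    (IsProjective.iff_projective (P.complex.X i)).2 (P.projective i)
  exact hS.map_of_exact (tensorRight (P.complex.X i))

/-- In the long exact sequence, `Tor_{i+1}` of the cokernel sits between `Tor_{i+1}` of the middle
term and `Tor_i` of the kernel. -/
theorem CategoryTheory.ShortComplex.ShortExact.hasFlatDimensionLT_X₃
    {S : ShortComplex (ModuleCat.{u} A)} (hS : S.ShortExact) {n : ℕ}
    (h₁ : HasFlatDimensionLT S.X₁ n) (h₂ : HasFlatDimensionLT S.X₂ (n + 1)) :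
    HasFlatDimensionLT S.X₃ (n + 1) := by
  intro i hi N
  obtain ⟨i, rfl⟩ := Nat.exists_eq_succ_of_ne_zero (by omega : i ≠ 0)
  let P := projectiveResolution N
  have H₁ := h₁ i (by omega) N
  have H₂ := h₂ (i + 1) hi N
  rw [isZero_tor_iff_exactAt _ P, HomologicalComplex.exactAt_iff_isZero_homology] at H₁ H₂ ⊢
  exact ((shortExact_tensor_projectiveResolution hS P).homology_exact₃ (i + 1) i
    (by simp)).isZero_X₂ (H₂.eq_of_src _ _) (H₁.eq_of_tgt _ _)

theorem TensorProduct.one_tmul_quotient_eq_zero_iff {X : Type*} [AddCommGroup X] [Module A X]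
    (a : Ideal A) (x : X) :
    (1 : A ⧸ a) ⊗ₜ[A] x = 0 ↔ x ∈ a • (⊤ : Submodule A X) := by
  rw [← (TensorProduct.quotTensorEquivQuotSMul X a).map_eq_zero_iff,
    ← map_one (Ideal.Quotient.mk a), TensorProduct.quotTensorEquivQuotSMul_mk_tmul, one_smul,
    Submodule.Quotient.mk_eq_zero]

/-- Every tensor in `(A ⧸ a) ⊗ Y` has the form `1 ⊗ y`. The elementwise criterion involves only
finitely many elements of `a` at a time, which suits directed unions. -/
theorem exact_lTensor_quotient_iff {X Y Z : Type*} [AddCommGroup X] [Module A X]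
    [AddCommGroup Y] [Module A Y] [AddCommGroup Z] [Module A Z] (f : X →ₗ[A] Y) (g : Y →ₗ[A] Z)
    (hfg : g ∘ₗ f = 0) (a : Ideal A) :
    Function.Exact (f.lTensor (A ⧸ a)) (g.lTensor (A ⧸ a)) ↔
      ∀ y, g y ∈ a • (⊤ : Submodule A Z) → ∃ x, y - f x ∈ a • (⊤ : Submodule A Y) := by
  have hY := TensorProduct.mk_surjective A Y (A ⧸ a) Ideal.Quotient.mk_surjective
  have hX := TensorProduct.mk_surjective A X (A ⧸ a) Ideal.Quotient.mk_surjective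
  constructor
  · intro h y hy
    obtain ⟨t, ht⟩ := (h ((1 : A ⧸ a) ⊗ₜ[A] y)).1 (by
      rw [LinearMap.lTensor_tmul, TensorProduct.one_tmul_quotient_eq_zero_iff]
      exact hy)
    obtain ⟨x, rfl⟩ := hX t
    refine ⟨x, ?_⟩
    rw [← TensorProduct.one_tmul_quotient_eq_zero_iff, TensorProduct.tmul_sub, sub_eq_zero, ← ht]
    rfl
  · intro h t
    obtain ⟨y, rfl⟩ := hY t
    constructor
    · intro hy
      rw [TensorProduct.mk_apply, LinearMap.lTensor_tmul,
        TensorProduct.one_tmul_quotient_eq_zero_iff] at hy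
      obtain ⟨x, hx⟩ := h y hy
      refine ⟨1 ⊗ₜ x, ?_⟩
      rw [← TensorProduct.one_tmul_quotient_eq_zero_iff, TensorProduct.tmul_sub, sub_eq_zero] at hx
      exact hx.symm
    · rintro ⟨s, hs⟩
      rw [← hs, ← LinearMap.comp_apply, ← LinearMap.lTensor_comp, hfg, LinearMap.lTensor_zero,
        LinearMap.zero_apply]

theorem exists_fg_le_mem_smul_top {X : Type*} [AddCommGroup X] [Module A X] {a : Ideal A} {x : X}
    (hx : x ∈ a • (⊤ : Submodule A X)) :
    ∃ c ≤ a, c.FG ∧ x ∈ c • (⊤ : Submodule A X) := by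
  induction hx using Submodule.smul_induction_on' with
  | smul r hr y hy =>
    exact ⟨Ideal.span {r}, by simpa [Ideal.span_le] using hr, ⟨{r}, by simp⟩,
      Submodule.smul_mem_smul (Ideal.mem_span_singleton_self r) trivial⟩
  | add y hy z hz ihy ihz =>
    obtain ⟨c, hc, hc', hy⟩ := ihy
    obtain ⟨d, hd, hd', hz⟩ := ihz
    exact ⟨c ⊔ d, sup_le hc hd, Submodule.FG.sup hc' hd', add_mem
      (Submodule.smul_mono_left le_sup_left hy) (Submodule.smul_mono_left le_sup_right hz)⟩

/-- Flat dimension is compatible with directed unions of ideals. -/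
theorem hasFlatDimensionLT_succ_residueModule_of_forall_fg {a : Ideal A} {n : ℕ}
    (h : ∀ c ≤ a, c.FG → ∃ b, c ≤ b ∧ b ≤ a ∧ HasFlatDimensionLT (residueModule b) (n + 1)) :
    HasFlatDimensionLT (residueModule a) (n + 1) := by
  intro i hi N
  obtain ⟨i, rfl⟩ := Nat.exists_eq_succ_of_ne_zero (by omega : i ≠ 0)
  -- Only `N` is resolved, so the same `P` computes Tor for `a` and for every smaller ideal `b`.
  let P := projectiveResolution N
  have hP : (P.complex.d (i + 1) i).hom ∘ₗ (P.complex.d (i + 2) (i + 1)).hom = 0 := by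
    rw [← ModuleCat.hom_comp, P.complex.d_comp_d, ModuleCat.hom_zero]
  refine (isZero_tor_succ_iff_exact _ P i).2 ((exact_lTensor_quotient_iff _ _ hP a).2 ?_)
  intro y hy
  obtain ⟨c, hca, hc, hy⟩ := exists_fg_le_mem_smul_top hy
  obtain ⟨b, hcb, hba, hb⟩ := h c hca hc
  obtain ⟨x, hx⟩ := (exact_lTensor_quotient_iff _ _ hP b).1
    ((isZero_tor_succ_iff_exact _ P i).1 (hb (i + 1) hi N)) y (Submodule.smul_mono_left hcb hy)
  exact ⟨x, Submodule.smul_mono_left hba hx⟩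

end Tor

/-! ### The exact sequence for attaching a generator -/

section Subquotient

variable {A : Type u} [CommRing A] {X : Type u} [AddCommGroup X] [Module A X]

/-- For submodules `I`, `Y`, `J` with `I ∩ (Y + J) ⊆ (I ∩ Y) + J`, the short exact sequence
`0 → (I ∩ Y) / (I ∩ Y ∩ J) → I / (I ∩ J) → I / (I ∩ (Y + J)) → 0`. -/
theorem exists_shortExact_submoduleOf (I Y J : Submodule A X) (h : I ⊓ (Y ⊔ J) ≤ (I ⊓ Y) ⊔ J) :
    ∃ (f : ModuleCat.of A (↥(I ⊓ Y) ⧸ J.submoduleOf (I ⊓ Y)) ⟶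
        ModuleCat.of A (I ⧸ J.submoduleOf I))
      (g : ModuleCat.of A (I ⧸ J.submoduleOf I) ⟶ ModuleCat.of A (I ⧸ (Y ⊔ J).submoduleOf I))
      (hfg : f ≫ g = 0), (ShortComplex.mk f g hfg).ShortExact := by
  let f : (↥(I ⊓ Y) ⧸ J.submoduleOf (I ⊓ Y)) →ₗ[A] (I ⧸ J.submoduleOf I) :=
    Submodule.mapQ _ _ (Submodule.inclusion inf_le_left) fun x hx ↦ hx
  let g : (I ⧸ J.submoduleOf I) →ₗ[A] (I ⧸ (Y ⊔ J).submoduleOf I) :=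
    Submodule.mapQ _ _ LinearMap.id fun x hx ↦ Submodule.mem_sup_right hx
  have hfg : Function.Exact f g := by
    intro t
    obtain ⟨x, rfl⟩ := Submodule.Quotient.mk_surjective _ t
    constructor
    · intro hx
      have hx' : (x : X) ∈ Y ⊔ J := (Submodule.Quotient.mk_eq_zero ((Y ⊔ J).submoduleOf I)).1 hx
      obtain ⟨a, ha, b, hb, hab⟩ := Submodule.mem_sup.1 (h ⟨x.2, hx'⟩)
      refine ⟨Submodule.Quotient.mk ⟨a, ha⟩, ?_⟩
      refine (Submodule.Quotient.eq _).2 ?_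
      change a - (x : X) ∈ J
      rw [← hab, sub_add_cancel_left]
      exact neg_mem hb
    · rintro ⟨s, hs⟩
      obtain ⟨s, rfl⟩ := Submodule.Quotient.mk_surjective _ s
      rw [← hs]
      exact (Submodule.Quotient.mk_eq_zero ((Y ⊔ J).submoduleOf I)).2
        (Submodule.mem_sup_left (S := Y) s.2.2)
  have hf : Function.Injective f := by
    rw [← LinearMap.ker_eq_bot, LinearMap.ker_eq_bot']
    intro t ht
    obtain ⟨x, rfl⟩ := Submodule.Quotient.mk_surjective _ t
    exact (Submodule.Quotient.mk_eq_zero _).2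
      ((Submodule.Quotient.mk_eq_zero (J.submoduleOf I)).1 ht)
  have hg : Function.Surjective g := by
    intro t
    obtain ⟨x, rfl⟩ := Submodule.Quotient.mk_surjective _ t
    exact ⟨Submodule.Quotient.mk x, rfl⟩
  refine ⟨ModuleCat.ofHom f, ModuleCat.ofHom g, ?_, ?_⟩
  · exact ModuleCat.hom_ext hfg.linearMap_comp_eq_zero
  · exact
      { exact := (ShortComplex.ShortExact.moduleCat_exact_iff_function_exact _).2 hfg
        mono_f := (ModuleCat.mono_iff_injective _).2 hf
        epi_g := (ModuleCat.epi_iff_surjective _).2 hg }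

end Subquotient

/-! ### Radicals and `p`-power roots in perfect rings -/

section PerfectRing

variable {A : Type u} [CommRing A] (p : ℕ) [Fact p.Prime] [CharP A p] [PerfectRing A p]

include p in
-- If `x^(p^n) = a + b`, then `x` is the sum of the `p^n`-th roots of `a` and `b`, by additivity and
-- injectivity of Frobenius.
theorem Ideal.radical_sup_of_perfectRing (I J : Ideal A) :
    (I ⊔ J).radical = I.radical ⊔ J.radical := by
  refine le_antisymm ?_ (sup_le (Ideal.radical_mono le_sup_left) (Ideal.radical_mono le_sup_right))
  rintro x ⟨n, hn⟩
  have hx : x ^ p ^ n ∈ I ⊔ J :=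
    Ideal.pow_mem_of_pow_mem _ hn (Nat.lt_pow_self (Fact.out : p.Prime).one_lt).le
  obtain ⟨a, ha, b, hb, hab⟩ := Submodule.mem_sup.1 hx
  obtain ⟨a, rfl⟩ := (bijective_iterateFrobenius A p n).2 a
  obtain ⟨b, rfl⟩ := (bijective_iterateFrobenius A p n).2 b
  have : x = a + b := by
    apply (bijective_iterateFrobenius A p n).1
    rw [map_add, hab, iterateFrobenius_def]
  rw [this]
  exact add_mem (Ideal.mem_sup_left ⟨_, ha⟩) (Ideal.mem_sup_right ⟨_, hb⟩)

/-- The `p ^ n`-th root of an element of a perfect ring. -/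
noncomputable def perfectRoot (w : A) (n : ℕ) : A :=
  (iterateFrobeniusEquiv A p n).symm w

theorem perfectRoot_pow (w : A) (n : ℕ) : perfectRoot p w n ^ p ^ n = w :=
  (iterateFrobeniusEquiv A p n).apply_symm_apply w

theorem perfectRoot_succ_pow (w : A) (n : ℕ) :
    perfectRoot p w (n + 1) ^ p = perfectRoot p w n := by
  apply (bijective_iterateFrobenius A p n).1
  rw [iterateFrobenius_def, iterateFrobenius_def, perfectRoot_pow, ← pow_mul, ← pow_succ',
    perfectRoot_pow]

theorem perfectRoot_mem_radical (w : A) (n : ℕ) :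
    perfectRoot p w n ∈ (Ideal.span {w}).radical :=
  ⟨p ^ n, by rw [perfectRoot_pow]; exact Ideal.mem_span_singleton_self w⟩

theorem perfectRoot_dvd_of_le (w : A) {m n : ℕ} (h : m ≤ n) :
    perfectRoot p w n ∣ perfectRoot p w m := by
  induction n, h using Nat.le_induction with
  | base => exact dvd_rfl
  | succ n _ ih =>
    exact (dvd_pow_self _ (Fact.out : p.Prime).ne_zero).trans
      ((perfectRoot_succ_pow p w n).dvd.trans ih)

theorem exists_perfectRoot_dvd_of_mem_radical {w x : A} (hx : x ∈ (Ideal.span {w}).radical) :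
    ∃ n, perfectRoot p w n ∣ x := by
  obtain ⟨n, hn⟩ := hx
  obtain ⟨a, ha⟩ := Ideal.mem_span_singleton'.1
    (Ideal.pow_mem_of_pow_mem _ hn (Nat.lt_pow_self (n := n) (Fact.out : p.Prime).one_lt).le)
  obtain ⟨a, rfl⟩ := (bijective_iterateFrobenius A p n).2 a
  refine ⟨n, a, (bijective_iterateFrobenius A p n).1 ?_⟩
  rw [map_mul, iterateFrobenius_def, ← ha, iterateFrobenius_def p n (perfectRoot p w n),
    perfectRoot_pow, mul_comm]

theorem exists_perfectRoot_dvd_forall {w : A} {ι : Type*} [Finite ι] (x : ι → A)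
    (hx : ∀ i, x i ∈ (Ideal.span {w}).radical) : ∃ n, ∀ i, perfectRoot p w n ∣ x i := by
  choose n hn using fun i ↦ exists_perfectRoot_dvd_of_mem_radical p (hx i)
  obtain ⟨N, hN⟩ := (Set.finite_range n).bddAbove
  exact ⟨N, fun i ↦ (perfectRoot_dvd_of_le p w (hN ⟨i, rfl⟩)).trans (hn i)⟩

theorem perfectRoot_ne_zero {w : A} (hw : w ≠ 0) (n : ℕ) : perfectRoot p w n ≠ 0 := by
  intro h
  apply hw
  rw [← perfectRoot_pow p w n, h, zero_pow (pow_ne_zero _ (Fact.out : p.Prime).ne_zero)]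

variable [IsDomain A]

include p in
-- By the equational criterion: the finitely many elements in a relation are multiples of one root
-- of `w`, which cancels in a domain when `w ≠ 0`.
theorem flat_radical_span_singleton (w : A) : Module.Flat A (Ideal.span {w}).radical := by
  obtain rfl | hw := eq_or_ne w 0
  · have : (Ideal.span {(0 : A)}).radical = ⊥ := by
      rw [Ideal.span_singleton_zero]
      exact (Ideal.isPrime_bot (α := A)).radical
    rw [this]
    infer_instance
  refine Module.Flat.of_forall_isTrivialRelation fun {l f x} hfx ↦ ?_
  obtain ⟨n, hn⟩ := exists_perfectRoot_dvd_forall p (fun i ↦ (x i : A)) fun i ↦ (x i).2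
  choose a ha using hn
  refine ⟨1, fun i _ ↦ a i, fun _ ↦ ⟨_, perfectRoot_mem_radical p w n⟩, fun i ↦ ?_, fun _ ↦ ?_⟩
  · ext
    simp [ha i, mul_comm]
  · have : perfectRoot p w n * ∑ i, f i * a i = 0 := by
      rw [Finset.mul_sum]
      have := congrArg Subtype.val hfx
      simp only [Submodule.coe_sum, Submodule.coe_smul, smul_eq_mul, ZeroMemClass.coe_zero] at this
      rw [← this]
      exact Finset.sum_congr rfl fun i _ ↦ by rw [ha i]; ring
    exact (mul_eq_zero.1 this).resolve_left (perfectRoot_ne_zero p hw n)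

end PerfectRing

/-! ### Projective dimension of a telescope -/

section Telescope

variable {A : Type u} [CommRing A] {N : Type u} [AddCommGroup N] [Module A N]

/-- The map `e n ↦ e n - c n • e (n + 1)` of the countably generated free module. -/
noncomputable def telescopeMap (c : ℕ → A) : (ℕ →₀ A) →ₗ[A] (ℕ →₀ A) :=
  Finsupp.linearCombination A fun n ↦ Finsupp.single n 1 - c n • Finsupp.single (n + 1) 1

theorem telescopeMap_single (c : ℕ → A) (n : ℕ) (a : A) :
    telescopeMap c (Finsupp.single n a) = Finsupp.single n a - Finsupp.single (n + 1) (a * c n) := by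
  simp [telescopeMap, smul_sub]

theorem telescopeMap_apply_zero (c : ℕ → A) (f : ℕ →₀ A) : telescopeMap c f 0 = f 0 := by
  induction f using Finsupp.induction_linear with
  | zero => simp
  | add f g hf hg => simp [hf, hg]
  | single n a => simp [telescopeMap_single]

theorem telescopeMap_apply_succ (c : ℕ → A) (f : ℕ →₀ A) (n : ℕ) :
    telescopeMap c f (n + 1) = f (n + 1) - f n * c n := by
  induction f using Finsupp.induction_linear with
  | zero => simp
  | add f g hf hg => simp only [map_add, Finsupp.add_apply, hf, hg]; ring
  | single m a =>
    rw [telescopeMap_single, Finsupp.sub_apply, Finsupp.single_apply (a := m + 1)]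
    obtain rfl | h := eq_or_ne m n
    · simp
    · simp [h]

theorem telescopeMap_injective (c : ℕ → A) : Function.Injective (telescopeMap c) := by
  rw [← LinearMap.ker_eq_bot, LinearMap.ker_eq_bot']
  intro f hf
  ext n
  induction n with
  | zero => rw [← telescopeMap_apply_zero c f, hf]
  | succ n ih =>
    have := telescopeMap_apply_succ c f n
    rw [ih, hf] at this
    simpa using this.symm

/-- Modulo the range, `e m` equals `c m • e (m + 1)`, so a finitely supported vector can be pushed
into any single sufficiently late coordinate. -/
theorem exists_sub_single_mem_range_telescopeMap (c : ℕ → A) (f : ℕ →₀ A) :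
    ∃ N : ℕ, ∀ n ≥ N, ∃ a, f - Finsupp.single n a ∈ LinearMap.range (telescopeMap c) := by
  induction f using Finsupp.induction_linear with
  | zero => exact ⟨0, fun n _ ↦ ⟨0, by simp⟩⟩
  | add f g hf hg =>
    obtain ⟨N, hN⟩ := hf
    obtain ⟨M, hM⟩ := hg
    refine ⟨max N M, fun n hn ↦ ?_⟩
    obtain ⟨a, ha⟩ := hN n (le_of_max_le_left hn)
    obtain ⟨b, hb⟩ := hM n (le_of_max_le_right hn)
    exact ⟨a + b, by simpa only [Finsupp.single_add, add_sub_add_comm] using add_mem ha hb⟩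
  | single m a =>
    refine ⟨m, fun n hn ↦ ?_⟩
    induction n, hn using Nat.le_induction with
    | base => exact ⟨a, by simp⟩
    | succ n _ ih =>
      obtain ⟨b, hb⟩ := ih
      refine ⟨b * c n, ?_⟩
      have := add_mem hb ⟨Finsupp.single n b, telescopeMap_single c n b⟩
      simpa using this

/-- The union of a chain of cyclic submodules `A z₀ ⊆ A z₁ ⊆ ⋯`, each free on its generator,
has projective dimension at most one. -/
theorem hasProjectiveDimensionLT_two_of_telescope (z : ℕ → N) (c : ℕ → A)
    (hz : ∀ n, z n = c n • z (n + 1)) (hspan : Submodule.span A (Set.range z) = ⊤)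
    (hreg : ∀ (n : ℕ) (a : A), a • z n = 0 → a = 0) :
    HasProjectiveDimensionLT (ModuleCat.of A N) 2 := by
  let π : (ℕ →₀ A) →ₗ[A] N := Finsupp.linearCombination A z
  have hπ : π ∘ₗ telescopeMap c = 0 := by
    ext n
    simp [π, telescopeMap_single, hz n]
  have hex : Function.Exact (telescopeMap c) π := by
    intro f
    constructor
    · intro hf
      obtain ⟨M, hM⟩ := exists_sub_single_mem_range_telescopeMap c f
      obtain ⟨a, g, hg⟩ := hM M le_rfl
      have : a • z M = 0 := by
        have h := LinearMap.congr_fun hπ g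
        rw [LinearMap.comp_apply, hg, map_sub, hf, LinearMap.zero_apply, zero_sub,
          neg_eq_zero] at h
        simpa [π] using h
      rw [hreg M a this, Finsupp.single_zero, sub_zero] at hg
      exact ⟨g, hg⟩
    · rintro ⟨g, rfl⟩
      exact LinearMap.congr_fun hπ g
  have hsurj : Function.Surjective π := by
    rw [← LinearMap.range_eq_top, Finsupp.range_linearCombination, hspan]
  have hS := ModuleCat.shortComplex_shortExact
    (ModuleCat.shortComplexOfCompEqZero (telescopeMap c) π hπ) hex (telescopeMap_injective c) hsurj
  have : Projective (ModuleCat.of A (ℕ →₀ A)) := (IsProjective.iff_projective _).1 inferInstance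
  exact hS.hasProjectiveDimensionLT_X₃ 1 (inferInstanceAs
    (HasProjectiveDimensionLT (ModuleCat.of A (ℕ →₀ A)) 1)) (inferInstanceAs
    (HasProjectiveDimensionLT (ModuleCat.of A (ℕ →₀ A)) (1 + 1)))

end Telescope

/-! ### Dimension bounds for radicals of finitely generated ideals -/

section PerfectRing

variable {A : Type u} [CommRing A] (p : ℕ) [Fact p.Prime] [CharP A p] [PerfectRing A p]

include p in
theorem hasProjectiveDimensionLT_radical_span_singleton [IsDomain A] (w : A) :
    HasProjectiveDimensionLT (ModuleCat.of A (Ideal.span {w}).radical) 2 := by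
  obtain rfl | hw := eq_or_ne w 0
  · have h : (Ideal.span {(0 : A)}).radical = ⊥ := by
      rw [Ideal.span_singleton_zero]
      exact (Ideal.isPrime_bot (α := A)).radical
    have : Limits.IsZero (ModuleCat.of A (Ideal.span {(0 : A)}).radical) := by
      rw [ModuleCat.isZero_of_iff_subsingleton, h]
      infer_instance
    have := this.hasProjectiveDimensionLT_zero
    exact hasProjectiveDimensionLT_of_ge _ 0 2 (by simp)
  refine hasProjectiveDimensionLT_two_of_telescope
    (fun n ↦ ⟨perfectRoot p w n, perfectRoot_mem_radical p w n⟩)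
    -- Consecutive roots satisfy `z n = z (n + 1) ^ p`, hence the transition factor `z (n + 1) ^ (p
    -- - 1)`.
    (fun n ↦ perfectRoot p w (n + 1) ^ (p - 1)) (fun n ↦ ?_) ?_ fun n a ha ↦ ?_
  · ext
    change _ = _ * _
    rw [← pow_succ, Nat.sub_add_cancel (Fact.out : p.Prime).one_le, perfectRoot_succ_pow]
  · refine eq_top_iff.2 fun x _ ↦ ?_
    obtain ⟨n, b, hb⟩ := exists_perfectRoot_dvd_of_mem_radical p x.2
    have : x = b • ⟨perfectRoot p w n, perfectRoot_mem_radical p w n⟩ := by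
      ext
      simp [hb, mul_comm]
    rw [this]
    exact Submodule.smul_mem _ _ (Submodule.subset_span ⟨n, rfl⟩)
  · exact (mul_eq_zero.1 (congrArg Subtype.val ha)).resolve_right (perfectRoot_ne_zero p hw n)

include p in
/-- Any bound that holds for the ideals `√(w)` of a perfect domain, and that grows by at most one
at the cokernel of a short exact sequence, holds for `A ⧸ √(x₁, …, xₖ)` up to an error of `k`. -/
theorem residueModule_radical_ofList_of_shortExact [IsDomain A]
    {Q : ℕ → ModuleCat.{u} A → Prop} {n₀ : ℕ}
    (hiso : ∀ {n M M'}, Q n M → (M ≅ M') → Q n M')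
    (hsucc : ∀ {n M}, Q n M → Q (n + 1) M)
    (hses : ∀ {n} {S : ShortComplex (ModuleCat.{u} A)}, S.ShortExact → Q n S.X₁ →
      Q (n + 1) S.X₂ → Q (n + 1) S.X₃)
    (hbase : ∀ w : A, Q n₀ (ModuleCat.of A (Ideal.span {w}).radical)) (l : List A) :
    Q (n₀ + l.length) (residueModule (Ideal.ofList l).radical) := by
  -- Quantifying over all `w` closes the induction, since the kernel term involves `w * y`; the case
  -- `w = 1` is the desired quotient.
  have key : ∀ (l : List A) (w : A), Q (n₀ + l.length) (ModuleCat.of A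
      ((Ideal.span {w}).radical ⧸
        Submodule.submoduleOf (Ideal.ofList l).radical (Ideal.span {w}).radical)) := by
    intro l
    induction l with
    | nil =>
      intro w
      refine hiso (hbase w) (LinearEquiv.toModuleIso (Submodule.quotEquivOfEqBot _ ?_).symm)
      rw [Ideal.ofList_nil, (Ideal.isPrime_bot (α := A)).radical]
      exact Submodule.ker_subtype _
    | cons y l ih =>
      intro w
      have hY : (Ideal.span {w * y}).radical =
          (Ideal.span {w}).radical ⊓ (Ideal.span {y}).radical := by
        rw [← Ideal.span_singleton_mul_span_singleton, Ideal.radical_mul]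
      have hJ : (Ideal.ofList (y :: l)).radical =
          (Ideal.span {y}).radical ⊔ (Ideal.ofList l).radical := by
        rw [Ideal.ofList_cons, Ideal.radical_sup_of_perfectRing p]
      obtain ⟨f, g, hfg, hS⟩ := exists_shortExact_submoduleOf (Ideal.span {w}).radical
        (Ideal.span {y}).radical (Ideal.ofList l).radical (by
          rw [← Ideal.radical_sup_of_perfectRing p, ← Ideal.radical_mul, Ideal.mul_sup,
            Ideal.radical_sup_of_perfectRing p, Ideal.radical_mul, Ideal.radical_mul]
          exact sup_le_sup le_rfl inf_le_right)
      rw [hJ]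
      refine hses hS ?_ (hsucc (ih w))
      have h := ih (w * y)
      rwa [hY] at h
  refine hiso (key l 1) (LinearEquiv.toModuleIso ?_)
  have h1 : (Ideal.span {(1 : A)}).radical = ⊤ := by
    rw [Ideal.span_singleton_one, Ideal.radical_top]
  rw [h1]
  exact Submodule.Quotient.equiv _ _ Submodule.topEquiv (by ext x; simp [Submodule.submoduleOf])

include p in
theorem hasFlatDimensionLT_residueModule_radical_ofList [IsDomain A] (l : List A) :
    HasFlatDimensionLT (residueModule (Ideal.ofList l).radical) (l.length + 1) := by
  rw [add_comm]
  refine residueModule_radical_ofList_of_shortExact p (Q := fun n M ↦ HasFlatDimensionLT M n)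
    (fun h e ↦ h.of_iso e) (fun h ↦ h.mono (Nat.le_succ _))
    (fun hS h₁ h₂ ↦ hS.hasFlatDimensionLT_X₃ h₁ h₂) (fun w ↦ ?_) l
  have := flat_radical_span_singleton p w
  exact hasFlatDimensionLT_one_of_flat _

include p in
theorem hasProjectiveDimensionLT_residueModule_radical_ofList [IsDomain A] (l : List A) :
    HasProjectiveDimensionLT (residueModule (Ideal.ofList l).radical) (l.length + 2) := by
  rw [add_comm]
  exact residueModule_radical_ofList_of_shortExact p
    (Q := fun n M ↦ HasProjectiveDimensionLT M n)
    (fun h e ↦ hasProjectiveDimensionLT_of_iso e _)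
    (fun {n M} h ↦ hasProjectiveDimensionLT_of_ge M n (n + 1) (Nat.le_succ _))
    (fun hS h₁ h₂ ↦ hS.hasProjectiveDimensionLT_X₃ _ h₁ h₂)
    (hasProjectiveDimensionLT_radical_span_singleton p) l

end PerfectRing

/-! ### Generation up to radical by `dim R` elements -/

section SetTheoreticGeneration

/-- Prime avoidance: `I` contains sequences of any length `k` such that all primes that contain the
sequence but not `I` have height at least `k` and avoid the finite set `T`. -/
theorem exists_list_forall_isPrime_le_height {S : Type*} [CommRing S] [IsNoetherianRing S]
    (I : Ideal S) {T : Set (Ideal S)} (hT : T.Finite) (hT' : ∀ P ∈ T, P.IsPrime) (k : ℕ) :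
    ∃ l : List S, l.length = k ∧ Ideal.ofList l ≤ I ∧ ∀ P : Ideal S, P.IsPrime →
      Ideal.ofList l ≤ P → ¬ I ≤ P → k ≤ P.height ∧ (0 < k → P ∉ T) := by
  induction k with
  | zero => exact ⟨[], rfl, by simp, by simp⟩
  | succ k ih =>
    obtain ⟨l, hl, hlI, hP⟩ := ih
    let B : Set (Ideal S) := {P | (P ∈ (Ideal.ofList l).minimalPrimes ∨ P ∈ T) ∧ ¬ I ≤ P}
    have hB : B.Finite :=
      (((Ideal.ofList l).finite_minimalPrimes_of_isNoetherianRing).union hT).subset fun _ h ↦ h.1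
    have hB' : ∀ P ∈ B, P.IsPrime := fun P h ↦ h.1.elim (fun h ↦ h.1.1) (hT' P)
    have : ¬ (I : Set S) ⊆ ⋃ P ∈ B, (P : Set S) := by
      rw [Ideal.subset_union_prime_finite hB ⊥ ⊥ fun P h _ _ ↦ hB' P h]
      rintro ⟨P, hPB, hIP⟩
      exact hPB.2 hIP
    obtain ⟨x, hxI, hx⟩ := Set.not_subset.1 this
    simp only [Set.mem_iUnion, not_exists] at hx
    refine ⟨x :: l, by simp [hl], ?_, fun P hPp hle hIP ↦ ?_⟩
    · rw [Ideal.ofList_cons]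
      exact sup_le ((Ideal.span_singleton_le_iff_mem I).2 hxI) hlI
    rw [Ideal.ofList_cons, sup_le_iff, Ideal.span_singleton_le_iff_mem] at hle
    refine ⟨?_, fun _ hPT ↦ hx P ⟨.inr hPT, hIP⟩ hle.1⟩
    obtain ⟨q, hq, hqP⟩ := Ideal.exists_minimalPrimes_le hle.2
    have hIq : ¬ I ≤ q := fun h ↦ hIP (h.trans hqP)
    have hxq : x ∉ q := hx q ⟨.inl hq, hIq⟩
    have := hq.1.1
    -- The new element avoids the minimal prime `q` of the old sequence, so passing from `q` to `P`
    -- raises the height.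
    have hlt : q < P := lt_of_le_of_ne hqP fun h ↦ hxq (h ▸ hle.1)
    refine le_trans ?_ (Ideal.height_add_one_le_of_lt_of_isPrime hlt)
    push_cast
    gcongr
    exact (hP q hq.1.1 hq.1.2 hIq).1

/-- In a semilocal Noetherian domain of dimension at most `d`, every proper ideal is generated by
`d` elements up to radical. -/
theorem exists_list_length_eq_radical_eq {S : Type*} [CommRing S] [IsDomain S] [IsNoetherianRing S]
    (hS : {P : Ideal S | P.IsMaximal}.Finite) {d : ℕ} (hd : ringKrullDim S ≤ d) {I : Ideal S}
    (hI : I ≠ ⊤) :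
    ∃ l : List S, l.length = d ∧ (Ideal.ofList l).radical = I.radical := by
  -- An empty sequence cannot avoid the maximal ideals; in dimension zero the domain is a field and
  -- `I = 0`.
  obtain rfl | hd0 := d.eq_zero_or_pos
  · have : Ring.KrullDimLE 0 S := (Order.krullDimLE_iff 0 _).2 hd
    let := (Ring.KrullDimLE.isField_of_isDomain (R := S)).toField
    refine ⟨[], rfl, ?_⟩
    rw [(Ideal.eq_bot_or_top I).resolve_right hI, Ideal.ofList_nil]
  obtain ⟨l, hl, hlI, hP⟩ := exists_list_forall_isPrime_le_height I hS (fun P h ↦ h.isPrime) d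
  refine ⟨l, hl, le_antisymm (Ideal.radical_mono hlI) ?_⟩
  rw [Ideal.radical_le_radical_iff, Ideal.radical_eq_sInf]
  refine le_sInf fun P ⟨hlP, hPp⟩ ↦ ?_
  by_contra hIP
  obtain ⟨hdP, hPm⟩ := hP P hPp hlP hIP
  obtain ⟨M, hM, hPM⟩ := Ideal.exists_le_maximal P hPp.ne_top
  have hlt : P < M := lt_of_le_of_ne hPM fun h ↦ hPm hd0 (h ▸ hM)
  have hMp := hM.isPrime
  -- A prime over the sequence but not over `I` has height at least `d` and is not maximal, so some
  -- maximal ideal would be too high.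
  have h1 : ((d + 1 : ℕ) : ℕ∞) ≤ M.height := by
    push_cast
    exact (add_le_add_left hdP 1).trans (Ideal.height_add_one_le_of_lt_of_isPrime hlt)
  have h2 : ((M.height : ℕ∞) : WithBot ℕ∞) ≤ d := Ideal.height_le_ringKrullDim_of_isPrime.trans hd
  have h3 : M.height ≤ d := by exact_mod_cast h2
  have := h1.trans h3
  norm_cast at this
  omega

theorem ringKrullDim_le_of_isIntegral (R S : Type*) [CommRing R] [CommRing S] [Algebra R S]
    [Algebra.IsIntegral R S] : ringKrullDim S ≤ ringKrullDim R :=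
  Order.krullDim_le_of_strictMono (PrimeSpectrum.comap (algebraMap R S)) fun _ _ h ↦
    Ideal.IsIntegral.comap_lt_comap (R := R) h

theorem finite_setOf_isMaximal_of_finite (R S : Type*) [CommRing R] [IsLocalRing R] [CommRing S]
    [Algebra R S] [Module.Finite R S] : {P : Ideal S | P.IsMaximal}.Finite := by
  refine (Algebra.QuasiFinite.finite_primesOver (R := R) (S := S)
    (IsLocalRing.maximalIdeal R)).subset fun P (hP : P.IsMaximal) ↦ ⟨hP.isPrime, ⟨?_⟩⟩
  have := Ideal.isMaximal_comap_of_isIntegral_of_isMaximal (R := R) P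
  exact (IsLocalRing.eq_maximalIdeal this).symm

/-- In an integral extension of a Noetherian local ring of dimension at most `d`, a finitely
generated subideal of a proper radical ideal `a` lies in the radical of `d` elements of `a`. -/
theorem exists_list_le_radical_of_fg {R A : Type*} [CommRing R] [IsLocalRing R]
    [IsNoetherianRing R] [CommRing A] [IsDomain A] [Algebra R A] [Algebra.IsIntegral R A] {d : ℕ}
    (hd : ringKrullDim R ≤ d) {a c : Ideal A} (ha : a.IsRadical) (ha' : a ≠ ⊤) (hca : c ≤ a)
    (hc : c.FG) :
    ∃ l : List A, l.length = d ∧ (Ideal.ofList l).radical ≤ a ∧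
      c ≤ (Ideal.ofList l).radical := by
  obtain ⟨T, rfl⟩ := hc
  -- This subring is finite over `R`, hence Noetherian, semilocal and of dimension at most `d`; the
  -- generators are found for the contraction of `a` to it.
  let S := Algebra.adjoin R (T : Set A)
  have : Module.Finite R S := Module.Finite.iff_fg.2
    (fg_adjoin_of_finite T.finite_toSet fun x _ ↦ Algebra.IsIntegral.isIntegral x)
  have : IsNoetherianRing S := IsNoetherianRing.of_finite R S
  obtain ⟨l, hl, hrad⟩ := exists_list_length_eq_radical_eq (finite_setOf_isMaximal_of_finite R S)
    ((ringKrullDim_le_of_isIntegral R S).trans hd) (I := a.comap S.val) (Ideal.comap_ne_top _ ha')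
  have hmap : Ideal.ofList (l.map S.val) = (Ideal.ofList l).map S.val :=
    (Ideal.map_ofList _ _).symm
  refine ⟨l.map S.val, by simp [hl], ha.radical_le_iff.2 ?_, Ideal.span_le.2 fun x hx ↦ ?_⟩
  · rw [hmap, Ideal.map_le_iff_le_comap, ← (ha.comap S.val).radical, ← hrad]
    exact Ideal.le_radical
  · have hxS : x ∈ S := Algebra.subset_adjoin hx
    have : (⟨x, hxS⟩ : S) ∈ (Ideal.ofList l).radical := by
      rw [hrad]
      exact Ideal.le_radical (hca (Ideal.subset_span hx))
    rw [hmap]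
    exact Ideal.map_radical_le _ (Ideal.mem_map_of_mem S.val this)

/-- If every element of `A` has a power in `R`, a Noetherian local domain of dimension at most `d`,
then every proper radical ideal of `A` is the radical of an ideal generated by `d` elements. -/
theorem exists_list_radical_eq_of_forall_pow_mem_range {R A : Type*} [CommRing R] [IsDomain R]
    [IsLocalRing R] [IsNoetherianRing R] [CommRing A] [Algebra R A]
    (hA : ∀ x : A, ∃ n : ℕ, 0 < n ∧ x ^ n ∈ Set.range (algebraMap R A)) {d : ℕ}
    (hd : ringKrullDim R ≤ d) {a : Ideal A} (ha : a.IsRadical) (ha' : a ≠ ⊤) :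
    ∃ l : List A, l.length = d ∧ (Ideal.ofList l).radical = a := by
  obtain ⟨l, hl, hrad⟩ := exists_list_length_eq_radical_eq (finite_setOf_isMaximal_of_finite R R)
    hd (I := a.comap (algebraMap R A)) (Ideal.comap_ne_top _ ha')
  rw [(ha.comap _).radical] at hrad
  refine ⟨l.map (algebraMap R A), by simp [hl], ?_⟩
  rw [← Ideal.map_ofList]
  refine le_antisymm (ha.radical_le_iff.2 (Ideal.map_le_iff_le_comap.2 ?_)) fun x hx ↦ ?_
  · exact Ideal.le_radical.trans hrad.le
  · obtain ⟨n, hn, r, hr⟩ := hA x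
    have : r ∈ (Ideal.ofList l).radical := by
      rw [hrad, Ideal.mem_comap, hr]
      exact Ideal.pow_mem_of_mem _ hx n hn
    have := Ideal.map_radical_le _ (Ideal.mem_map_of_mem (algebraMap R A) this)
    rw [hr] at this
    exact Ideal.mem_radical_of_pow_mem this

end SetTheoreticGeneration

/-! ### Dimension bounds over perfect integral extensions -/

section IntegralExtension

theorem isZero_residueModule_top {A : Type u} [CommRing A] :
    Limits.IsZero (residueModule (⊤ : Ideal A)) :=
  ModuleCat.isZero_of_iff_subsingleton.2 inferInstance

theorem exists_nat_ringKrullDim_eq (R : Type*) [CommRing R] [IsLocalRing R] [IsNoetherianRing R] :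
    ∃ d : ℕ, ringKrullDim R = d := by
  obtain ⟨d, hd⟩ := ENat.ne_top_iff_exists.1
    (Ideal.height_ne_top (IsLocalRing.maximalIdeal.isMaximal R).ne_top)
  exact ⟨d, by rw [← IsLocalRing.maximalIdeal_height_eq_ringKrullDim, ← hd]; rfl⟩

variable {A : Type u} [CommRing A] [IsDomain A] (p : ℕ) [Fact p.Prime] [CharP A p]
  [PerfectRing A p]

include p in
theorem flatDimension_residueModule_le_ringKrullDim {R : Type*} [CommRing R] [IsLocalRing R]
    [IsNoetherianRing R] [Algebra R A] [Algebra.IsIntegral R A] {a : Ideal A} (ha : a.IsRadical) :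
    flatDimension (residueModule a) ≤ ringKrullDim R := by
  obtain rfl | ha' := eq_or_ne a ⊤
  · rw [flatDimension_eq_bot_of_isZero isZero_residueModule_top]
    exact bot_le
  obtain ⟨d, hd⟩ := exists_nat_ringKrullDim_eq R
  rw [hd]
  refine flatDimension_le_of_hasFlatDimensionLT
    (hasFlatDimensionLT_succ_residueModule_of_forall_fg fun c hca hc ↦ ?_)
  obtain ⟨l, rfl, hla, hcl⟩ := exists_list_le_radical_of_fg hd.le ha ha' hca hc
  exact ⟨_, hcl, hla, hasFlatDimensionLT_residueModule_radical_ofList p l⟩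

include p in
theorem projectiveDimension_residueModule_le_ringKrullDim_add_one {R : Type*} [CommRing R]
    [IsDomain R] [IsLocalRing R] [IsNoetherianRing R] [Algebra R A]
    (hA : ∀ x : A, ∃ n : ℕ, 0 < n ∧ x ^ n ∈ Set.range (algebraMap R A))
    {a : Ideal A} (ha : a.IsRadical) :
    projectiveDimension (residueModule a) ≤ ringKrullDim R + 1 := by
  obtain rfl | ha' := eq_or_ne a ⊤
  · rw [(projectiveDimension_eq_bot_iff _).2 isZero_residueModule_top]
    exact bot_le
  obtain ⟨d, hd⟩ := exists_nat_ringKrullDim_eq R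
  obtain ⟨l, rfl, rfl⟩ := exists_list_radical_eq_of_forall_pow_mem_range hA hd.le ha ha'
  rw [hd]
  exact (projectiveDimension_le_iff _ (l.length + 1)).2
    (hasProjectiveDimensionLT_residueModule_radical_ofList p l)

end IntegralExtension

/-! ### Perfectness of the two closures -/

section Closures

/-- Roots exist in the algebraically closed `L` and lie in `S` by hypothesis; Frobenius is injective
because `S` is reduced. -/
theorem Subalgebra.perfectRing_of_forall_pow_mem {R L : Type*} [CommRing R] [Field L]
    [IsAlgClosed L] [Algebra R L] (p : ℕ) [Fact p.Prime] (S : Subalgebra R L) [CharP S p]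
    (hS : ∀ x, x ^ p ∈ S → x ∈ S) : PerfectRing S p :=
  PerfectRing.ofSurjective S p fun x ↦ by
    obtain ⟨y, hy⟩ := IsAlgClosed.exists_pow_nat_eq (x : L) (Fact.out : p.Prime).pos
    exact ⟨⟨y, hS y (hy ▸ x.2)⟩, Subtype.ext hy⟩

theorem pow_mem_range_of_mem_perfectClosureOfDomain {R L : Type*} [CommRing R] [Field L]
    [Algebra R L] {p : ℕ} [Fact p.Prime] [CharP R p] (x : perfectClosureOfDomain R L p) :
    ∃ n : ℕ, 0 < n ∧ x ^ n ∈ Set.range (algebraMap R (perfectClosureOfDomain R L p)) := by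
  obtain ⟨-, n, r, hr⟩ := x.2
  exact ⟨p ^ n, pow_pos (Fact.out : p.Prime).pos n, r, Subtype.ext hr⟩

end Closures

theorem proposition10p2
    (R : Type u) [CommRing R] [IsDomain R] [IsLocalRing R] [IsNoetherianRing R]
    (p : ℕ) [Fact p.Prime] [CharP R p]
    (K : Type v) [Field K] [Algebra R K] [IsFractionRing R K]
    (L : Type w) [Field L] [Algebra K L] [IsAlgClosure K L] [Algebra R L] [IsScalarTower R K L] :
    -- flat dimensions over the perfect closure
    (⨆ a : {a : Ideal (perfectClosureOfDomain R L p) // a.IsRadical},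
        flatDimension (residueModule a.1)) ≤ ringKrullDim R ∧
    -- flat dimensions over the absolute integral closure
    (⨆ a : {a : Ideal (absoluteIntegralClosure R L) // a.IsRadical},
        flatDimension (residueModule a.1)) ≤ ringKrullDim R ∧
    -- projective dimensions over the perfect closure
    (⨆ a : {a : Ideal (perfectClosureOfDomain R L p) // a.IsRadical},
        projectiveDimension (residueModule a.1)) ≤ ringKrullDim R + 1 := by
  have : IsAlgClosed L := IsAlgClosure.isAlgClosed K
  have : CharP L p := (CharP.charP_iff_prime_eq_zero Fact.out).2 <| by
    rw [← map_natCast (algebraMap R L) p, CharP.cast_eq_zero, map_zero]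
  have hchar (S : Subalgebra R L) : CharP S p :=
    (CharP.charP_iff_prime_eq_zero Fact.out).2 (Subtype.ext (by simp))
  have := hchar (perfectClosureOfDomain R L p)
  have := hchar (absoluteIntegralClosure R L)
  have hp : 0 < p := (Fact.out : p.Prime).pos
  have : PerfectRing (absoluteIntegralClosure R L) p :=
    Subalgebra.perfectRing_of_forall_pow_mem p _ fun x hx ↦ IsIntegral.of_pow hp hx
  have : PerfectRing (perfectClosureOfDomain R L p) p :=
    Subalgebra.perfectRing_of_forall_pow_mem p _ fun x ⟨hx, n, hn⟩ ↦
      -- Here `(x^p)^(p^n)` lies in `R`, so the exponent for `x` itself is one larger.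
      ⟨IsIntegral.of_pow hp hx, n + 1, by rwa [pow_succ', pow_mul]⟩
  have : Algebra.IsIntegral R (perfectClosureOfDomain R L p) := ⟨fun x ↦
    (isIntegral_algHom_iff (perfectClosureOfDomain R L p).val Subtype.val_injective).1 x.2.1⟩
  exact ⟨iSup_le fun a ↦ flatDimension_residueModule_le_ringKrullDim p a.2,
    iSup_le fun a ↦ flatDimension_residueModule_le_ringKrullDim p a.2,
    iSup_le fun a ↦ projectiveDimension_residueModule_le_ringKrullDim_add_one p
      pow_mem_range_of_mem_perfectClosureOfDomain a.2⟩
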